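/- Let $\mathbb{D}=\{z\in\mathbb{C}:|z|<1\}$, and let $\mathcal{S}$ be the class of functions $f(z)=z+a_2z^2+a_3z^3+\cdots$ that are holomorphic and injective in $\mathbb{D}$. For holomorphic $g,h$ in $\mathbb{D}$ write $g\prec h$ if there is a holomorphic $\omega$ on $\mathbb{D}$ with $\omega(0)=0$, $|\omega(z)|<1$ and $g(z)=h(\omega(z))$ for all $z\in\mathbb{D}$. Let $$\mathcal{BT}_{\mathfrak B}=\{f\in\mathcal{S}: f'(z)\prec \sqrt{1+\tanh z}\}$$ (principal branch of the square root). The logarithmic coefficients $\gamma_n=\gamma_n(f)$ of $f\in\mathcal{S}$ are defined by $$\log\frac{f(z)}{z}=2\sum_{n=1}^{\infty}\gamma_n z^n,\qquad z\in\mathbb{D},\quad \log 1:=0 .$$ If $f\in\mathcal{BT}_{\mathfrak B}$, then the logarithmic coefficients of $f$ exist, the first four are given by $$\gamma_1=\tfrac12a_2,\quad \gamma_2=\tfrac12\left(a_3-\tfrac12a_2^2\right),\quad \gamma_3=\tfrac12\left(a_4-a_2a_3+\tfrac13a_2^3\right),\quad \gamma_4=\tfrac12\left(a_5-a_2a_4+a_2^2a_3-\tfrac12a_3^2-\tfrac14a_2^4\right),$$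 and $$|\gamma_n|\le\frac{1}{4(n+1)}\qquad\text{for } n=1,2,3,4.$$ The inequalities are sharp: for each $n\in\{1,2,3,4\}$ the function $$f_n(z)=\int_0^z\sqrt{1+\tanh (t^n)}\,dt$$ belongs to $\mathcal{BT}_{\mathfrak B}$ and satisfies $|\gamma_n(f_n)|=\frac{1}{4(n+1)}$. Moreover, as $z\to0$, $$f_1(z)=z+\frac{z^2}{4}-\frac{z^3}{24}-\frac{5z^4}{192}+\frac{17z^5}{1920}+O(z^6),\qquad f_2(z)=z+\frac{z^3}{6}-\frac{z^5}{40}-\frac{5z^7}{336}+O(z^9),$$ $$f_3(z)=z+\frac{z^4}{8}-\frac{z^7}{56}+O(z^{10}),\qquad f_4(z)=z+\frac{z^5}{10}-\frac{z^9}{72}+O(z^{13}).$$ -/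

import Mathlib

open scoped Topology Asymptotics

namespace BoundedTurning

/-- The open unit disk. -/
def unitDisk : Set ℂ := Metric.ball 0 1

/-- The class of functions holomorphic and univalent (injective) in the unit disk
with `f 0 = 0` and `f' 0 = 1`. -/
def ClassS : Set (ℂ → ℂ) :=
  {f | DifferentiableOn ℂ f unitDisk ∧ f 0 = 0 ∧ deriv f 0 = 1 ∧ Set.InjOn f unitDisk}

/-- Subordination `f ≺ g` in the unit disk, for `f` and `g` holomorphic there. -/
def Subordinate (f g : ℂ → ℂ) : Prop :=
  ∃ ω : ℂ → ℂ, DifferentiableOn ℂ ω unitDisk ∧ ω 0 = 0 ∧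
    (∀ z ∈ unitDisk, ‖ω z‖ < 1) ∧ ∀ z ∈ unitDisk, f z = g (ω z)

/-- The function `√(1 + tanh z)`, with the principal branch of the square root. On the unit disk
`1 + tanh z = 2 / (1 + exp (-2z))` avoids the nonpositive reals, so it is holomorphic there. -/
noncomputable def bean (z : ℂ) : ℂ := (1 + Complex.tanh z) ^ (1 / 2 : ℂ)

/-- The univalent functions whose derivative is subordinate to `√(1 + tanh z)`. -/
def ClassBT : Set (ℂ → ℂ) := {f | f ∈ ClassS ∧ Subordinate (deriv f) bean}

/-- The `n`-th Taylor coefficient of `f` at `0`. -/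
noncomputable def taylorCoeff (f : ℂ → ℂ) (n : ℕ) : ℂ := iteratedDeriv n f 0 / (n.factorial : ℂ)

/-- `γ 1, γ 2, …` are the logarithmic coefficients of `f`: in the unit disk,
`log (f z / z) = 2 * ∑_{n ≥ 1} γ n * z ^ n`, where the left-hand side is the holomorphic branch `F`
of the logarithm with `F 0 = log 1 = 0`. The value `γ 0` plays no role. -/
def IsLogCoeffs (f : ℂ → ℂ) (γ : ℕ → ℂ) : Prop :=
  ∃ F : ℂ → ℂ, DifferentiableOn ℂ F unitDisk ∧ F 0 = 0 ∧
    (∀ z ∈ unitDisk, z ≠ 0 → Complex.exp (F z) = f z / z) ∧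
    ∀ z ∈ unitDisk, HasSum (fun k : ℕ => 2 * (γ (k + 1) * z ^ (k + 1))) (F z)

/-- `f_n z = ∫_0^z √(1 + tanh (t ^ n)) dt`, integrated along the segment `t = s z`, `0 ≤ s ≤ 1`. -/
noncomputable def extremal (n : ℕ) (z : ℂ) : ℂ :=
  ∫ s in (0 : ℝ)..1, bean (((s : ℂ) * z) ^ n) * z

end BoundedTurning

/-!
For `f` with `f' = bean ∘ ω`, the differential equation `2 bean' = bean (2 - bean²)` expresses
`γ₁, …, γ₄` as polynomials in the Taylor coefficients `b₀, …, b₃` of `φ z = ω z / z`, with `b_{n-1}`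
entering `γₙ` linearly with the factor `1 / (4 (n + 1))`. By the Schwarz lemma `φ` belongs to the
Schur class, so by a theorem of Schur the lower triangular Toeplitz matrix of its coefficients is a
contraction; applying it to test vectors whose last output entry is the polynomial in question
bounds that polynomial by one. For `ω z = z ^ n` the polynomial has modulus one, and the
Noshiro–Warschawski criterion shows that the corresponding `f` is univalent.
-/

namespace BoundedTurning

open Complex Finset PowerSeries Set
open scoped ComplexConjugate

section TaylorSeries

/-- The Taylor series of `f` at `0` as a formal power series, so that identities between
holomorphic functions become identities in the ring `ℂ⟦X⟧`. -/
noncomputable def taylorSeries (f : ℂ → ℂ) : ℂ⟦X⟧ := PowerSeries.mk (taylorCoeff f)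

@[simp]
theorem coeff_taylorSeries (f : ℂ → ℂ) (n : ℕ) : coeff n (taylorSeries f) = taylorCoeff f n :=
  coeff_mk _ _

theorem taylorCoeff_zero (f : ℂ → ℂ) : taylorCoeff f 0 = f 0 := by simp [taylorCoeff]

theorem taylorSeries_congr {f g : ℂ → ℂ} (h : f =ᶠ[𝓝 0] g) : taylorSeries f = taylorSeries g := by
  ext n
  simp [taylorCoeff, h.iteratedDeriv_eq n]

theorem taylorCoeff_deriv (f : ℂ → ℂ) (n : ℕ) :
    taylorCoeff (deriv f) n = (n + 1) * taylorCoeff f (n + 1) := by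
  rw [taylorCoeff, taylorCoeff, iteratedDeriv_succ', Nat.factorial_succ]
  have hfac : (n.factorial : ℂ) ≠ 0 := mod_cast n.factorial_ne_zero
  have hsucc : (n : ℂ) + 1 ≠ 0 := mod_cast n.succ_ne_zero
  push_cast
  field_simp

theorem taylorSeries_deriv (f : ℂ → ℂ) : taylorSeries (deriv f) = d⁄dX ℂ (taylorSeries f) := by
  ext n
  rw [coeff_derivative, coeff_taylorSeries, coeff_taylorSeries, taylorCoeff_deriv, mul_comm]

theorem taylorSeries_const (c : ℂ) : taylorSeries (fun _ => c) = C c := by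
  ext n
  rw [coeff_taylorSeries, taylorCoeff, iteratedDeriv_const, coeff_C]
  split_ifs with h <;> simp [h]

theorem taylorSeries_pow_id (n : ℕ) : taylorSeries (fun z => z ^ n) = X ^ n := by
  ext k
  have hfac : (k.factorial : ℂ) ≠ 0 := mod_cast k.factorial_ne_zero
  rw [coeff_taylorSeries, taylorCoeff, iteratedDeriv_fun_pow_zero, coeff_X_pow]
  rcases eq_or_ne k n with rfl | hkn <;> simp [*]

theorem taylorSeries_id : taylorSeries (fun z => z) = X := by
  simpa using taylorSeries_pow_id 1

theorem taylorSeries_add {f g : ℂ → ℂ} (hf : AnalyticAt ℂ f 0) (hg : AnalyticAt ℂ g 0) :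
    taylorSeries (fun z => f z + g z) = taylorSeries f + taylorSeries g := by
  ext n
  simp only [coeff_taylorSeries, map_add, taylorCoeff, ← add_div]
  rw [iteratedDeriv_fun_add hf.contDiffAt hg.contDiffAt]

theorem taylorSeries_sub {f g : ℂ → ℂ} (hf : AnalyticAt ℂ f 0) (hg : AnalyticAt ℂ g 0) :
    taylorSeries (fun z => f z - g z) = taylorSeries f - taylorSeries g := by
  ext n
  simp only [coeff_taylorSeries, map_sub, taylorCoeff, ← sub_div]
  rw [iteratedDeriv_fun_sub hf.contDiffAt hg.contDiffAt]

theorem coeff_mul_eq_sum_range (a b : ℂ⟦X⟧) (n : ℕ) :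
    coeff n (a * b) = ∑ i ∈ range (n + 1), coeff i a * coeff (n - i) b := by
  rw [coeff_mul, Finset.Nat.sum_antidiagonal_eq_sum_range_succ_mk]

theorem taylorSeries_mul {f g : ℂ → ℂ} (hf : AnalyticAt ℂ f 0) (hg : AnalyticAt ℂ g 0) :
    taylorSeries (fun z => f z * g z) = taylorSeries f * taylorSeries g := by
  ext n
  rw [coeff_mul_eq_sum_range, coeff_taylorSeries, taylorCoeff,
    iteratedDeriv_fun_mul hf.contDiffAt hg.contDiffAt, Finset.sum_div]
  refine Finset.sum_congr rfl fun i hi => ?_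
  have hfac (k : ℕ) : (k.factorial : ℂ) ≠ 0 := mod_cast k.factorial_ne_zero
  have := hfac n
  have := hfac i
  have := hfac (n - i)
  rw [coeff_taylorSeries, coeff_taylorSeries, taylorCoeff, taylorCoeff,
    Nat.cast_choose ℂ (Finset.mem_range_succ_iff.1 hi)]
  field_simp

theorem mul_dslope_zero {f : ℂ → ℂ} (h0 : f 0 = 0) (z : ℂ) : z * dslope f 0 z = f z := by
  simpa [h0] using sub_smul_dslope f 0 z

theorem X_mul_taylorSeries_dslope {f : ℂ → ℂ} (hf : AnalyticAt ℂ f 0) (h0 : f 0 = 0) :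
    X * taylorSeries (dslope f 0) = taylorSeries f := by
  obtain ⟨p, hp⟩ := hf
  rw [← taylorSeries_id, ← taylorSeries_mul (by fun_prop)
    hp.has_fpower_series_dslope_fslope.analyticAt]
  simp_rw [mul_dslope_zero h0]

theorem taylorCoeff_dslope {f : ℂ → ℂ} (hf : AnalyticAt ℂ f 0) (h0 : f 0 = 0) (n : ℕ) :
    taylorCoeff (dslope f 0) n = taylorCoeff f (n + 1) := by
  rw [← coeff_taylorSeries, ← coeff_taylorSeries, ← X_mul_taylorSeries_dslope hf h0,
    coeff_succ_X_mul]

end TaylorSeries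

section UnitDisk

variable {f g : ℂ → ℂ} {z : ℂ}

theorem isOpen_unitDisk : IsOpen unitDisk := Metric.isOpen_ball

theorem convex_unitDisk : Convex ℝ unitDisk := convex_ball _ _

theorem mem_unitDisk : z ∈ unitDisk ↔ ‖z‖ < 1 := mem_ball_zero_iff

theorem zero_mem_unitDisk : (0 : ℂ) ∈ unitDisk := by simp [unitDisk]

theorem unitDisk_mem_nhds (hz : z ∈ unitDisk) : unitDisk ∈ 𝓝 z := isOpen_unitDisk.mem_nhds hz

theorem analyticAt_zero (hf : DifferentiableOn ℂ f unitDisk) : AnalyticAt ℂ f 0 :=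
  hf.analyticAt (unitDisk_mem_nhds zero_mem_unitDisk)

theorem hasDerivAt_of_mem_unitDisk (hf : DifferentiableOn ℂ f unitDisk) (hz : z ∈ unitDisk) :
    HasDerivAt f (deriv f z) z :=
  (hf.differentiableAt (unitDisk_mem_nhds hz)).hasDerivAt

theorem eventuallyEq_of_eqOn_unitDisk (h : EqOn f g unitDisk) (hz : z ∈ unitDisk) :
    f =ᶠ[𝓝 z] g :=
  h.eventuallyEq_of_mem (unitDisk_mem_nhds hz)

theorem differentiableOn_dslope_zero (hf : DifferentiableOn ℂ f unitDisk) :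
    DifferentiableOn ℂ (dslope f 0) unitDisk :=
  (differentiableOn_dslope (unitDisk_mem_nhds zero_mem_unitDisk)).2 hf

theorem hasSum_taylorCoeff (hf : DifferentiableOn ℂ f unitDisk) (hz : z ∈ unitDisk) :
    HasSum (fun n => taylorCoeff f n * z ^ n) (f z) := by
  refine (hasSum_taylorSeries_on_ball hf hz).congr_fun fun n => ?_
  simp only [taylorCoeff, sub_zero, smul_eq_mul]
  ring

theorem taylorCoeff_eq_of_hasSum {c : ℕ → ℂ}
    (h : ∀ z ∈ unitDisk, HasSum (fun n => c n * z ^ n) (f z)) : taylorCoeff f = c := by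
  have hc : HasFPowerSeriesAt f (FormalMultilinearSeries.ofScalars ℂ c) 0 := by
    rw [hasFPowerSeriesAt_iff']
    filter_upwards [unitDisk_mem_nhds zero_mem_unitDisk] with z hz
    simpa [FormalMultilinearSeries.coeff_ofScalars, mul_comm] using h z hz
  have heq := hc.analyticAt.hasFPowerSeriesAt.eq_formalMultilinearSeries hc
  ext n
  simpa [FormalMultilinearSeries.coeff_ofScalars, taylorCoeff] using
    congrArg (fun p => FormalMultilinearSeries.coeff p n) heq

end UnitDisk

section SchurClass

/-- The Schur class: holomorphic functions on the unit disk bounded by one. -/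
def SchurClass : Set (ℂ → ℂ) :=
  {φ | DifferentiableOn ℂ φ unitDisk ∧ ∀ z ∈ unitDisk, ‖φ z‖ ≤ 1}

theorem norm_sq_add_conj_mul_sub (c y s : ℂ) :
    ‖y + conj c * s‖ ^ 2 - ‖c * y + s‖ ^ 2 = (1 - ‖c‖ ^ 2) * (‖y‖ ^ 2 - ‖s‖ ^ 2) := by
  simp only [← normSq_eq_norm_sq, normSq_apply, add_re, add_im, mul_re, mul_im, conj_re, conj_im]
  ring

theorem norm_moebius_le_one {c w : ℂ} (hc : ‖c‖ ≤ 1) (hw : ‖w‖ ≤ 1) :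
    ‖(w - c) / (1 - conj c * w)‖ ≤ 1 := by
  rw [norm_div]
  refine div_le_one_of_le₀ ((sq_le_sq₀ (norm_nonneg _) (norm_nonneg _)).1 ?_) (norm_nonneg _)
  have hid : ‖1 - conj c * w‖ ^ 2 - ‖w - c‖ ^ 2 = (1 - ‖c‖ ^ 2) * (1 - ‖w‖ ^ 2) := by
    simpa [← sub_eq_add_neg, neg_add_eq_sub] using norm_sq_add_conj_mul_sub (-c) 1 w
  have hc2 : ‖c‖ ^ 2 ≤ 1 := pow_le_one₀ (norm_nonneg c) hc
  have hw2 : ‖w‖ ^ 2 ≤ 1 := pow_le_one₀ (norm_nonneg w) hw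
  linarith [mul_nonneg (sub_nonneg.2 hc2) (sub_nonneg.2 hw2)]

theorem dslope_mem_schurClass {g : ℂ → ℂ} (hg : g ∈ SchurClass) (h0 : g 0 = 0) :
    dslope g 0 ∈ SchurClass := by
  refine ⟨differentiableOn_dslope_zero hg.1, fun z hz => ?_⟩
  simpa using norm_dslope_le_div_of_mapsTo_ball (R₂ := 1) hg.1
    (fun w hw => by simpa [h0] using hg.2 w hw) hz

theorem exists_schur_step {φ : ℂ → ℂ} (hφ : φ ∈ SchurClass) :
    ∃ ψ ∈ SchurClass, ∀ z ∈ unitDisk, φ z * (1 + conj (φ 0) * (z * ψ z)) = φ 0 + z * ψ z := by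
  obtain ⟨hd, hb⟩ := hφ
  set c := φ 0 with hc
  rcases (hb 0 zero_mem_unitDisk).eq_or_lt with hc1 | hc1
  · have hmax : IsMaxOn (norm ∘ φ) unitDisk 0 := fun w hw => by simpa [hc1] using hb w hw
    have hconst := eqOn_of_isPreconnected_of_isMaxOn_norm convex_unitDisk.isPreconnected
      isOpen_unitDisk hd zero_mem_unitDisk hmax
    exact ⟨0, ⟨differentiableOn_const 0, by simp⟩, fun z hz => by simpa using hconst hz⟩
  have hden : ∀ z ∈ unitDisk, 1 - conj c * φ z ≠ 0 := by
    intro z hz h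
    have hone : ‖conj c * φ z‖ = 1 := by rw [← sub_eq_zero.1 h, norm_one]
    rw [norm_mul, RCLike.norm_conj] at hone
    exact (mul_lt_one_of_nonneg_of_lt_one_left (norm_nonneg c) hc1 (hb z hz)).ne hone
  set g : ℂ → ℂ := fun z => (φ z - c) / (1 - conj c * φ z) with hg
  have hg0 : g 0 = 0 := by simp [hg, hc]
  have hgS : g ∈ SchurClass := ⟨(hd.sub_const c).fun_div ((hd.const_mul _).const_sub 1) hden,
    fun z hz => norm_moebius_le_one hc1.le (hb z hz)⟩
  refine ⟨dslope g 0, dslope_mem_schurClass hgS hg0, fun z hz => ?_⟩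
  have hinv : g z * (1 - conj c * φ z) = φ z - c := div_mul_cancel₀ _ (hden z hz)
  rw [mul_dslope_zero hg0]
  linear_combination -hinv

theorem exists_schur_step_taylorSeries {φ : ℂ → ℂ} (hφ : φ ∈ SchurClass) :
    ∃ ψ ∈ SchurClass, taylorSeries φ * (1 + C (conj (φ 0)) * (X * taylorSeries ψ)) =
      C (φ 0) + X * taylorSeries ψ := by
  obtain ⟨ψ, hψ, hstep⟩ := exists_schur_step hφ
  have hφa := analyticAt_zero hφ.1
  have hψa := analyticAt_zero hψ.1
  refine ⟨ψ, hψ, ?_⟩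
  have hz : AnalyticAt ℂ (fun z : ℂ => z) 0 := analyticAt_id
  have hseries := taylorSeries_congr (eventuallyEq_of_eqOn_unitDisk hstep zero_mem_unitDisk)
  rw [taylorSeries_mul hφa (by fun_prop), taylorSeries_add (by fun_prop) (by fun_prop),
    taylorSeries_mul (by fun_prop) (by fun_prop), taylorSeries_add (by fun_prop) (by fun_prop),
    taylorSeries_mul hz hψa, taylorSeries_id] at hseries
  simpa only [taylorSeries_const, map_one] using hseries

theorem sum_norm_sq_coeff_taylorSeries_mul_le {φ : ℂ → ℂ} (hφ : φ ∈ SchurClass) (x : ℂ⟦X⟧)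
    (n : ℕ) : ∑ k ∈ range n, ‖coeff k (taylorSeries φ * x)‖ ^ 2 ≤
      ∑ k ∈ range n, ‖coeff k x‖ ^ 2 := by
  induction n generalizing φ x with
  | zero => simp
  | succ n ih =>
    obtain ⟨ψ, hψ, hstep⟩ := exists_schur_step_taylorSeries hφ
    set c := φ 0
    -- Substituting `x = D * y` turns `φ x` into `(c + X ψ) y`, so the two sums differ by
    -- `1 - ‖c‖ ^ 2` times the contraction defect of `X ψ` at `y`.
    set D : ℂ⟦X⟧ := 1 + C (conj c) * (X * taylorSeries ψ) with hD
    obtain ⟨y, rfl⟩ : ∃ y, x = D * y :=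
      ⟨D⁻¹ * x, by rw [← mul_assoc, PowerSeries.mul_inv_cancel _ (by simp [hD]), one_mul]⟩
    set s := taylorSeries ψ * y with hs
    have hx (k : ℕ) : coeff k (D * y) = coeff k y + conj c * coeff k (X * s) := by
      rw [← coeff_C_mul, ← map_add, hD, hs]
      congr 1
      ring
    have hφx (k : ℕ) : coeff k (taylorSeries φ * (D * y)) = c * coeff k y + coeff k (X * s) := by
      rw [← coeff_C_mul, ← map_add, ← mul_assoc, hstep, hs]
      congr 1
      ring
    have hshift : ∑ k ∈ range (n + 1), ‖coeff k (X * s)‖ ^ 2 = ∑ k ∈ range n, ‖coeff k s‖ ^ 2 := by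
      simp [Finset.sum_range_succ', coeff_succ_X_mul]
    have hys : ∑ k ∈ range (n + 1), ‖coeff k (X * s)‖ ^ 2 ≤
        ∑ k ∈ range (n + 1), ‖coeff k y‖ ^ 2 := by
      rw [hshift, Finset.sum_range_succ]
      exact (ih hψ y).trans (le_add_of_nonneg_right (sq_nonneg _))
    have hc : ‖c‖ ^ 2 ≤ 1 := pow_le_one₀ (norm_nonneg c) (hφ.2 0 zero_mem_unitDisk)
    rw [← sub_nonneg, ← Finset.sum_sub_distrib]
    simp only [hx, hφx, norm_sq_add_conj_mul_sub]
    rw [← Finset.mul_sum, Finset.sum_sub_distrib]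
    exact mul_nonneg (sub_nonneg.2 hc) (sub_nonneg.2 hys)

variable {φ : ℂ → ℂ} {α β μ ν : ℂ}

theorem norm_taylorCoeff_zero_le_one (hφ : φ ∈ SchurClass) : ‖taylorCoeff φ 0‖ ≤ 1 := by
  simpa [taylorCoeff_zero] using hφ.2 0 zero_mem_unitDisk

theorem sq_norm_mul_le_sq_norm (hμ : ‖μ‖ ≤ 1) (u : ℂ) : ‖μ * u‖ ^ 2 ≤ ‖u‖ ^ 2 := by
  rw [norm_mul]
  gcongr
  exact mul_le_of_le_one_left (norm_nonneg u) hμ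

theorem norm_taylorCoeff_one_add_le_one (hφ : φ ∈ SchurClass) (hμ : ‖μ‖ ≤ 1) :
    ‖taylorCoeff φ 1 + μ * taylorCoeff φ 0 ^ 2‖ ≤ 1 := by
  have h := sum_norm_sq_coeff_taylorSeries_mul_le hφ
    (PowerSeries.mk fun | 0 => 1 | 1 => μ * taylorCoeff φ 0 | _ => 0) 2
  simp only [coeff_mul_eq_sum_range, Finset.sum_range_succ, Finset.sum_range_zero, zero_add,
    coeff_taylorSeries, coeff_mk, Nat.reduceSub, norm_one, one_pow, mul_one] at h
  have hx := sq_norm_mul_le_sq_norm hμ (taylorCoeff φ 0)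
  rw [← sq_le_one_iff₀ (norm_nonneg _), show taylorCoeff φ 1 + μ * taylorCoeff φ 0 ^ 2 =
    taylorCoeff φ 0 * (μ * taylorCoeff φ 0) + taylorCoeff φ 1 by ring]
  linarith

theorem norm_taylorCoeff_two_add_le_one (hφ : φ ∈ SchurClass) (hμν : ‖μ‖ ^ 2 + ‖ν‖ ^ 2 ≤ 1) :
    ‖taylorCoeff φ 2 + μ * taylorCoeff φ 0 * taylorCoeff φ 1 + ν * taylorCoeff φ 0 ^ 3‖ ≤ 1 := by
  have hb0 := norm_taylorCoeff_zero_le_one hφ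
  set b := taylorCoeff φ with hb
  have h := sum_norm_sq_coeff_taylorSeries_mul_le hφ
    (PowerSeries.mk fun | 0 => 1 | 1 => μ * b 0 | 2 => ν * b 0 ^ 2 | _ => 0) 3
  simp only [coeff_mul_eq_sum_range, Finset.sum_range_succ, Finset.sum_range_zero, zero_add,
    coeff_taylorSeries, coeff_mk, Nat.reduceSub, norm_one, one_pow, mul_one, ← hb] at h
  have hx : ‖μ * b 0‖ ^ 2 + ‖ν * b 0 ^ 2‖ ^ 2 ≤ ‖b 0‖ ^ 2 := calc
    _ = ‖b 0‖ ^ 2 * (‖μ‖ ^ 2 + ‖ν‖ ^ 2 * ‖b 0‖ ^ 2) := by simp only [norm_mul, norm_pow]; ring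
    _ ≤ ‖b 0‖ ^ 2 * 1 := by
      gcongr
      refine (add_le_add_right (mul_le_of_le_one_right (sq_nonneg _) ?_) _).trans hμν
      exact pow_le_one₀ (norm_nonneg _) hb0
    _ = ‖b 0‖ ^ 2 := mul_one _
  rw [← sq_le_one_iff₀ (norm_nonneg _), show b 2 + μ * b 0 * b 1 + ν * b 0 ^ 3 =
    b 0 * (ν * b 0 ^ 2) + b 1 * (μ * b 0) + b 2 by ring]
  linarith [sq_nonneg ‖b 0 * (μ * b 0) + b 1‖]

theorem sq_norm_add_le_weighted {p q : ℝ} (hp : 0 < p) (hq : 0 < q) (α β u v : ℂ) :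
    ‖α * u + β * v‖ ^ 2 ≤ (‖α‖ ^ 2 / p + ‖β‖ ^ 2 / q) * (p * ‖u‖ ^ 2 + q * ‖v‖ ^ 2) := by
  have htri : ‖α * u + β * v‖ ≤ ‖α‖ * ‖u‖ + ‖β‖ * ‖v‖ := by
    simpa only [norm_mul] using norm_add_le (α * u) (β * v)
  have hdefect : (‖α‖ ^ 2 / p + ‖β‖ ^ 2 / q) * (p * ‖u‖ ^ 2 + q * ‖v‖ ^ 2) -
      (‖α‖ * ‖u‖ + ‖β‖ * ‖v‖) ^ 2 = (q * ‖α‖ * ‖v‖ - p * ‖β‖ * ‖u‖) ^ 2 / (p * q) := by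
    field_simp
    ring
  refine (pow_le_pow_left₀ (norm_nonneg _) htri 2).trans (sub_nonneg.1 ?_)
  rw [hdefect]
  positivity

theorem norm_taylorCoeff_three_add_le_one (hφ : φ ∈ SchurClass) (hμ : ‖μ‖ < 1) (hν : ‖ν‖ < 1)
    (hαβ : ‖α‖ ^ 2 / (1 - ‖ν‖ ^ 2) + ‖β‖ ^ 2 / (1 - ‖μ‖ ^ 2) ≤ 1) :
    ‖taylorCoeff φ 3 + μ * taylorCoeff φ 0 * taylorCoeff φ 2 + ν * taylorCoeff φ 1 ^ 2 +
      (ν * μ + α) * taylorCoeff φ 0 ^ 2 * taylorCoeff φ 1 +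
      (α * μ + β) * taylorCoeff φ 0 ^ 4‖ ≤ 1 := by
  have hb0 := norm_taylorCoeff_zero_le_one hφ
  set b := taylorCoeff φ with hb
  set v := b 1 + μ * b 0 ^ 2
  -- The outputs `b 0` and `v` of this test vector absorb its own entries; the last output is the
  -- functional to be bounded.
  have h := sum_norm_sq_coeff_taylorSeries_mul_le hφ (PowerSeries.mk fun
    | 0 => 1 | 1 => μ * b 0 | 2 => ν * v | 3 => b 0 * (α * v + β * b 0 ^ 2) | _ => 0) 4
  simp only [coeff_mul_eq_sum_range, Finset.sum_range_succ, Finset.sum_range_zero, zero_add,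
    coeff_taylorSeries, coeff_mk, Nat.reduceSub, norm_one, one_pow, mul_one, ← hb] at h
  rw [show b 0 * (μ * b 0) + b 1 = v by ring] at h
  have hμ2 : 0 < 1 - ‖μ‖ ^ 2 := sub_pos.2 (pow_lt_one₀ (norm_nonneg μ) hμ two_ne_zero)
  have hν2 : 0 < 1 - ‖ν‖ ^ 2 := sub_pos.2 (pow_lt_one₀ (norm_nonneg ν) hν two_ne_zero)
  have hx3 : ‖b 0 * (α * v + β * b 0 ^ 2)‖ ^ 2 ≤
      (1 - ‖ν‖ ^ 2) * ‖v‖ ^ 2 + (1 - ‖μ‖ ^ 2) * ‖b 0‖ ^ 2 := calc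
    _ ≤ ‖α * v + β * b 0 ^ 2‖ ^ 2 := sq_norm_mul_le_sq_norm hb0 _
    _ ≤ 1 * ((1 - ‖ν‖ ^ 2) * ‖v‖ ^ 2 + (1 - ‖μ‖ ^ 2) * ‖b 0 ^ 2‖ ^ 2) :=
      (sq_norm_add_le_weighted hν2 hμ2 α β v _).trans (by gcongr)
    _ ≤ _ := by
      rw [one_mul, sq (b 0)]
      gcongr _ + _ * ?_
      exact sq_norm_mul_le_sq_norm hb0 _
  rw [← sq_le_one_iff₀ (norm_nonneg _), show b 3 + μ * b 0 * b 2 + ν * b 1 ^ 2 +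
      (ν * μ + α) * b 0 ^ 2 * b 1 + (α * μ + β) * b 0 ^ 4 =
    b 0 * (b 0 * (α * v + β * b 0 ^ 2)) + b 1 * (ν * v) + b 2 * (μ * b 0) + b 3 by ring]
  simp only [norm_mul μ, norm_mul ν, mul_pow] at h
  linarith [sq_nonneg ‖b 0 * (ν * v) + b 1 * (μ * b 0) + b 2‖]

end SchurClass

section LogarithmicCoefficients

theorem derivative_taylorSeries_of_eqOn_exp {F G : ℂ → ℂ} (hF : DifferentiableOn ℂ F unitDisk)
    (hG : ∀ z ∈ unitDisk, G z = exp (F z)) :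
    d⁄dX ℂ (taylorSeries G) = d⁄dX ℂ (taylorSeries F) * taylorSeries G := by
  have hGd : DifferentiableOn ℂ G unitDisk := hF.cexp.congr hG
  have hode : EqOn (deriv G) (fun z => deriv F z * G z) unitDisk := fun z hz => by
    simp only [(eventuallyEq_of_eqOn_unitDisk hG hz).deriv_eq,
      (hasDerivAt_of_mem_unitDisk hF hz).cexp.deriv, hG z hz, mul_comm]
  rw [← taylorSeries_deriv, ← taylorSeries_deriv,
    ← taylorSeries_mul (analyticAt_zero hF).deriv (analyticAt_zero hGd)]
  exact taylorSeries_congr (eventuallyEq_of_eqOn_unitDisk hode zero_mem_unitDisk)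

theorem coeff_eq_of_derivative_eq_derivative_mul {Γ G : ℂ⟦X⟧} (hG : coeff 0 G = 1)
    (h : d⁄dX ℂ G = d⁄dX ℂ Γ * G) :
    coeff 1 Γ = coeff 1 G ∧
    coeff 2 Γ = coeff 2 G - 1 / 2 * coeff 1 G ^ 2 ∧
    coeff 3 Γ = coeff 3 G - coeff 1 G * coeff 2 G + 1 / 3 * coeff 1 G ^ 3 ∧
    coeff 4 Γ = coeff 4 G - coeff 1 G * coeff 3 G + coeff 1 G ^ 2 * coeff 2 G -
      1 / 2 * coeff 2 G ^ 2 - 1 / 4 * coeff 1 G ^ 4 := by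
  have hrec (n : ℕ) : coeff (n + 1) G * (n + 1) =
      ∑ i ∈ range (n + 1), coeff (i + 1) Γ * (i + 1) * coeff (n - i) G := by
    simpa only [coeff_mul_eq_sum_range, coeff_derivative] using congrArg (coeff n) h
  have e0 := hrec 0
  have e1 := hrec 1
  have e2 := hrec 2
  have e3 := hrec 3
  simp only [Finset.sum_range_succ, Finset.sum_range_zero, zero_add, Nat.reduceAdd, Nat.reduceSub,
    Nat.cast_zero, Nat.cast_one, Nat.cast_ofNat, mul_one, hG] at e0 e1 e2 e3
  have g1 : coeff 1 Γ = coeff 1 G := by linear_combination -e0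
  rw [g1] at e1 e2 e3
  have g2 : coeff 2 Γ = coeff 2 G - 1 / 2 * coeff 1 G ^ 2 := by linear_combination -e1 / 2
  rw [g2] at e2 e3
  have g3 : coeff 3 Γ = coeff 3 G - coeff 1 G * coeff 2 G + 1 / 3 * coeff 1 G ^ 3 := by
    linear_combination -e2 / 3
  rw [g3] at e3
  exact ⟨g1, g2, g3, by linear_combination -e3 / 4⟩

theorem IsLogCoeffs.eq_taylorCoeff {f : ℂ → ℂ} {γ : ℕ → ℂ} (hf : DifferentiableOn ℂ f unitDisk)
    (h0 : f 0 = 0) (h1 : deriv f 0 = 1) (hγ : IsLogCoeffs f γ) {a : ℕ → ℂ}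
    (ha : a = taylorCoeff f) :
    γ 1 = 1 / 2 * a 2 ∧
    γ 2 = 1 / 2 * (a 3 - 1 / 2 * a 2 ^ 2) ∧
    γ 3 = 1 / 2 * (a 4 - a 2 * a 3 + 1 / 3 * a 2 ^ 3) ∧
    γ 4 = 1 / 2 * (a 5 - a 2 * a 4 + a 2 ^ 2 * a 3 - 1 / 2 * a 3 ^ 2 - 1 / 4 * a 2 ^ 4) := by
  obtain ⟨F, hF, hF0, hexp, hsum⟩ := hγ
  have hGexp : ∀ z ∈ unitDisk, dslope f 0 z = exp (F z) := by
    intro z hz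
    rcases eq_or_ne z 0 with rfl | hne
    · simp [hF0, h1]
    · rw [hexp z hz hne, ← mul_dslope_zero h0 z, mul_div_cancel_left₀ _ hne]
  have hFc : taylorCoeff F = fun n => if n = 0 then 0 else 2 * γ n := by
    refine taylorCoeff_eq_of_hasSum fun z hz => ?_
    rw [← hasSum_nat_add_iff' 1]
    simpa [mul_assoc] using hsum z hz
  have hformulas := coeff_eq_of_derivative_eq_derivative_mul (by simp [taylorCoeff_zero, h1])
    (derivative_taylorSeries_of_eqOn_exp hF hGexp)
  simp only [coeff_taylorSeries, taylorCoeff_dslope (analyticAt_zero hf) h0, hFc, ← ha, one_ne_zero,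
    OfNat.ofNat_ne_zero, if_false, Nat.reduceAdd] at hformulas
  obtain ⟨g1, g2, g3, g4⟩ := hformulas
  refine ⟨?_, ?_, ?_, ?_⟩
  · linear_combination g1 / 2
  · linear_combination g2 / 2
  · linear_combination g3 / 2
  · linear_combination g4 / 2

theorem exists_differentiableOn_exp_eq {g : ℂ → ℂ} {c w : ℂ} {r : ℝ}
    (hg : DifferentiableOn ℂ g (Metric.ball c r)) (hne : ∀ z ∈ Metric.ball c r, g z ≠ 0)
    (hw : exp w = g c) :
    ∃ F : ℂ → ℂ, DifferentiableOn ℂ F (Metric.ball c r) ∧ F c = w ∧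
      ∀ z ∈ Metric.ball c r, exp (F z) = g z := by
  have hopen : IsOpen (Metric.ball c r) := Metric.isOpen_ball
  obtain ⟨F, hFc, hF⟩ := ((hg.deriv hopen).fun_div hg hne).isExactOn_ball.with_val_at c w
  refine ⟨F, fun z hz => (hF z hz).differentiableAt.differentiableWithinAt, hFc, fun z hz => ?_⟩
  have hder : ∀ u ∈ Metric.ball c r, HasDerivAt (fun u => exp (-F u) * g u) 0 u := by
    intro u hu
    have hgu := (hg.differentiableAt (hopen.mem_nhds hu)).hasDerivAt
    refine ((hF u hu).fun_neg.cexp.mul hgu).congr_deriv ?_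
    have := hne u hu
    field_simp
    ring
  have hconst : exp (-F z) * g z = exp (-F c) * g c :=
    hopen.is_const_of_deriv_eq_zero (convex_ball c r).isPreconnected
      (fun u hu => (hder u hu).differentiableAt.differentiableWithinAt)
      (fun u hu => (hder u hu).deriv) hz (Metric.mem_ball_self (Metric.pos_of_mem_ball hz))
  rw [hFc, ← hw, ← exp_add, neg_add_cancel, exp_zero, exp_neg] at hconst
  exact (inv_mul_eq_one₀ (exp_ne_zero _)).1 hconst

theorem exists_isLogCoeffs {f : ℂ → ℂ} (hf : f ∈ ClassS) : ∃ γ : ℕ → ℂ, IsLogCoeffs f γ := by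
  obtain ⟨hd, h0, h1, hinj⟩ := hf
  have hG0 : dslope f 0 0 = 1 := by simp [h1]
  have hne : ∀ z ∈ unitDisk, dslope f 0 z ≠ 0 := by
    intro z hz h
    have hfz : f z = f 0 := by rw [← mul_dslope_zero h0 z, h, mul_zero, h0]
    rw [hinj hz zero_mem_unitDisk hfz, hG0] at h
    exact one_ne_zero h
  obtain ⟨F, hF, hF0, hexp⟩ := exists_differentiableOn_exp_eq (differentiableOn_dslope_zero hd) hne
    (exp_zero.trans hG0.symm)
  refine ⟨fun n => taylorCoeff F n / 2, F, hF, hF0, fun z hz hz0 => ?_, fun z hz => ?_⟩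
  · rw [hexp z hz, ← mul_dslope_zero h0 z, mul_div_cancel_left₀ _ hz0]
  · have hsum := (hasSum_nat_add_iff' 1).2 (hasSum_taylorCoeff hF hz)
    have hterm (k : ℕ) : 2 * (taylorCoeff F (k + 1) / 2 * z ^ (k + 1)) =
        taylorCoeff F (k + 1) * z ^ (k + 1) := by ring
    simpa [hterm, taylorCoeff_zero, hF0] using hsum

end LogarithmicCoefficients

section Bean

theorem one_add_exp_mem_slitPlane {u : ℂ} (hu : |u.im| < Real.pi) : 1 + exp u ∈ slitPlane := by
  rw [abs_lt] at hu
  rw [mem_slitPlane_iff]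
  rcases eq_or_ne u.im 0 with h0 | h0
  · left
    rw [add_re, one_re, exp_re, h0, Real.cos_zero, mul_one]
    positivity
  · right
    rw [add_im, one_im, zero_add, exp_im]
    refine mul_ne_zero (Real.exp_pos _).ne' fun hsin => h0 ?_
    exact (Real.sin_eq_zero_iff_of_lt_of_lt hu.1 hu.2).1 hsin

variable {z : ℂ}

theorem one_add_exp_neg_two_mul_mem_slitPlane (hz : |z.im| < Real.pi / 2) :
    1 + exp (-2 * z) ∈ slitPlane := by
  refine one_add_exp_mem_slitPlane ?_
  have him : (-2 * z).im = -2 * z.im := by simp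
  rw [him, abs_mul, abs_neg, Nat.abs_ofNat]
  linarith

theorem cosh_eq_exp_mul (z : ℂ) : cosh z = exp z * (1 + exp (-2 * z)) / 2 := by
  rw [cosh, mul_add, mul_one, ← exp_add]
  ring_nf

theorem cosh_ne_zero_of_abs_im_lt (hz : |z.im| < Real.pi / 2) : cosh z ≠ 0 := by
  rw [cosh_eq_exp_mul]
  have hden := slitPlane_ne_zero (one_add_exp_neg_two_mul_mem_slitPlane hz)
  exact div_ne_zero (mul_ne_zero (exp_ne_zero z) hden) two_ne_zero

theorem one_add_tanh_eq (hz : |z.im| < Real.pi / 2) :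
    1 + tanh z = (2 : ℝ) / (1 + exp (-2 * z)) := by
  rw [tanh_eq_sinh_div_cosh, one_add_div (cosh_ne_zero_of_abs_im_lt hz), cosh_add_sinh,
    cosh_eq_exp_mul, div_div_eq_mul_div, mul_div_mul_left _ _ (exp_ne_zero z), ofReal_ofNat]

theorem ofReal_div_mem_slitPlane {r : ℝ} {w : ℂ} (hr : 0 < r) (hw : w ∈ slitPlane) :
    r / w ∈ slitPlane := by
  have hnormSq : 0 < normSq w := normSq_pos.2 (slitPlane_ne_zero hw)
  rw [div_eq_mul_inv, mem_slitPlane_iff, re_ofReal_mul, im_ofReal_mul, inv_re, inv_im]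
  refine (mem_slitPlane_iff.1 hw).imp (fun hre => by positivity) fun him => ?_
  exact mul_ne_zero hr.ne' (div_ne_zero (neg_ne_zero.2 him) hnormSq.ne')

theorem one_add_tanh_mem_slitPlane (hz : |z.im| < Real.pi / 2) : 1 + tanh z ∈ slitPlane := by
  rw [one_add_tanh_eq hz]
  exact ofReal_div_mem_slitPlane two_pos (one_add_exp_neg_two_mul_mem_slitPlane hz)

theorem bean_sq (z : ℂ) : bean z ^ 2 = 1 + tanh z := by simp [bean]

theorem bean_zero : bean 0 = 1 := by simp [bean]

theorem re_cpow_one_half_pos {w : ℂ} (hw : w ∈ slitPlane) : 0 < (w ^ (1 / 2 : ℂ)).re := by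
  rw [one_div, cpow_inv_two_re]
  refine Real.sqrt_pos.2 (half_pos (neg_lt_iff_pos_add.1 ?_))
  rcases mem_slitPlane_iff.1 hw with hre | him
  · exact (neg_neg_of_pos hre).trans_le (norm_nonneg w)
  · exact (neg_le_abs _).trans_lt (abs_re_lt_norm.2 him)

theorem bean_re_pos (hz : |z.im| < Real.pi / 2) : 0 < (bean z).re :=
  re_cpow_one_half_pos (one_add_tanh_mem_slitPlane hz)

theorem hasDerivAt_one_add_tanh (hz : |z.im| < Real.pi / 2) :
    HasDerivAt (fun z => 1 + tanh z) ((1 + tanh z) * (1 - tanh z)) z := by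
  have hcosh := cosh_ne_zero_of_abs_im_lt hz
  have hder := ((hasDerivAt_sinh z).fun_div (hasDerivAt_cosh z) hcosh).const_add 1
  simp only [← tanh_eq_sinh_div_cosh] at hder
  refine hder.congr_deriv ?_
  rw [tanh_eq_sinh_div_cosh]
  field_simp
  ring

theorem hasDerivAt_bean (hz : |z.im| < Real.pi / 2) :
    HasDerivAt bean (bean z * (2 - bean z ^ 2) / 2) z := by
  have hslit := one_add_tanh_mem_slitPlane hz
  refine ((hasDerivAt_one_add_tanh hz).cpow_const (c := 1 / 2) hslit).congr_deriv ?_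
  rw [bean_sq, cpow_sub _ _ (slitPlane_ne_zero hslit), cpow_one, bean]
  have := slitPlane_ne_zero hslit
  field_simp
  ring

theorem abs_im_lt_pi_div_two_of_mem_unitDisk (hz : z ∈ unitDisk) : |z.im| < Real.pi / 2 :=
  (abs_im_le_norm z).trans_lt (by linarith [mem_unitDisk.1 hz, Real.pi_gt_three])

theorem differentiableOn_bean : DifferentiableOn ℂ bean unitDisk := fun _ hz =>
  have hder := hasDerivAt_bean (abs_im_lt_pi_div_two_of_mem_unitDisk hz)
  hder.differentiableAt.differentiableWithinAt

end Bean

section BoundedTurningClass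

/-- Schwarz functions: the holomorphic self-maps of the unit disk fixing the origin, which are the
`ω` of a subordination `g = h ∘ ω`. -/
def SchwarzClass : Set (ℂ → ℂ) :=
  {ω | DifferentiableOn ℂ ω unitDisk ∧ ω 0 = 0 ∧ ∀ z ∈ unitDisk, ‖ω z‖ < 1}

theorem dslope_mem_schurClass_of_mem_schwarzClass {ω : ℂ → ℂ} (hω : ω ∈ SchwarzClass) :
    dslope ω 0 ∈ SchurClass :=
  dslope_mem_schurClass ⟨hω.1, fun z hz => (hω.2.2 z hz).le⟩ hω.2.1

theorem derivative_taylorSeries_of_eqOn_bean_comp {ω p : ℂ → ℂ} (hω : ω ∈ SchwarzClass)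
    (hp : ∀ z ∈ unitDisk, p z = bean (ω z)) :
    C 2 * d⁄dX ℂ (taylorSeries p) =
      d⁄dX ℂ (taylorSeries ω) * (taylorSeries p * (C 2 - taylorSeries p * taylorSeries p)) := by
  obtain ⟨hωd, -, hb⟩ := hω
  have hpd : DifferentiableOn ℂ p unitDisk :=
    (differentiableOn_bean.comp hωd fun z hz => mem_unitDisk.2 (hb z hz)).congr hp
  have hode : EqOn (fun z => 2 * deriv p z) (fun z => deriv ω z * (p z * (2 - p z * p z)))
      unitDisk := fun z hz => by
    have hbean := hasDerivAt_bean (abs_im_lt_pi_div_two_of_mem_unitDisk (mem_unitDisk.2 (hb z hz)))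
    have hcomp := hbean.comp z (hasDerivAt_of_mem_unitDisk hωd hz)
    simp only [(hcomp.congr_of_eventuallyEq (eventuallyEq_of_eqOn_unitDisk hp hz)).deriv, hp z hz]
    ring
  have hpa := analyticAt_zero hpd
  have hpa' := hpa.deriv
  have hωa' := (analyticAt_zero hωd).deriv
  have hseries := taylorSeries_congr (eventuallyEq_of_eqOn_unitDisk hode zero_mem_unitDisk)
  rwa [taylorSeries_mul (by fun_prop) hpa', taylorSeries_mul hωa' (by fun_prop),
    taylorSeries_mul hpa (by fun_prop), taylorSeries_sub (by fun_prop) (by fun_prop),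
    taylorSeries_mul hpa hpa, taylorSeries_const, taylorSeries_deriv, taylorSeries_deriv] at hseries

theorem coeff_eq_of_two_mul_derivative_eq {P W : ℂ⟦X⟧} (hP : coeff 0 P = 1)
    (h : C 2 * d⁄dX ℂ P = d⁄dX ℂ W * (P * (C 2 - P * P))) :
    coeff 1 P = coeff 1 W / 2 ∧
    coeff 2 P = coeff 2 W / 2 - coeff 1 W ^ 2 / 8 ∧
    coeff 3 P = coeff 3 W / 2 - coeff 1 W * coeff 2 W / 4 - 5 / 48 * coeff 1 W ^ 3 ∧
    coeff 4 P = coeff 4 W / 2 - (2 * coeff 1 W * coeff 3 W + coeff 2 W ^ 2) / 8 -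
      5 / 16 * coeff 1 W ^ 2 * coeff 2 W + 17 / 384 * coeff 1 W ^ 4 := by
  have e0 := congrArg (coeff 0) h
  have e1 := congrArg (coeff 1) h
  have e2 := congrArg (coeff 2) h
  have e3 := congrArg (coeff 3) h
  simp only [coeff_C_mul, coeff_mul_eq_sum_range, map_sub, coeff_C, coeff_derivative,
    Finset.sum_range_succ, Finset.sum_range_zero, zero_add, Nat.reduceAdd, Nat.reduceSub,
    hP, if_true, one_ne_zero, if_false, OfNat.ofNat_ne_zero, zero_sub, Nat.cast_zero, Nat.cast_one,
    Nat.cast_ofNat, one_mul, mul_one] at e0 e1 e2 e3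
  have p1 : coeff 1 P = coeff 1 W / 2 := by linear_combination e0 / 2
  rw [p1] at e1 e2 e3
  have p2 : coeff 2 P = coeff 2 W / 2 - coeff 1 W ^ 2 / 8 := by linear_combination e1 / 4
  rw [p2] at e2 e3
  have p3 : coeff 3 P = coeff 3 W / 2 - coeff 1 W * coeff 2 W / 4 - 5 / 48 * coeff 1 W ^ 3 := by
    linear_combination e2 / 6
  rw [p3] at e3
  exact ⟨p1, p2, p3, by linear_combination e3 / 8⟩

theorem taylorCoeff_eq_of_eqOn_bean_comp {ω p : ℂ → ℂ} (hω : ω ∈ SchwarzClass)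
    (hp : ∀ z ∈ unitDisk, p z = bean (ω z)) {w : ℕ → ℂ} (hw : w = taylorCoeff ω) :
    taylorCoeff p 0 = 1 ∧
    taylorCoeff p 1 = w 1 / 2 ∧
    taylorCoeff p 2 = w 2 / 2 - w 1 ^ 2 / 8 ∧
    taylorCoeff p 3 = w 3 / 2 - w 1 * w 2 / 4 - 5 / 48 * w 1 ^ 3 ∧
    taylorCoeff p 4 = w 4 / 2 - (2 * w 1 * w 3 + w 2 ^ 2) / 8 - 5 / 16 * w 1 ^ 2 * w 2 +
      17 / 384 * w 1 ^ 4 := by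
  have hp0 : taylorCoeff p 0 = 1 := by
    rw [taylorCoeff_zero, hp 0 zero_mem_unitDisk, hω.2.1, bean_zero]
  refine ⟨hp0, ?_⟩
  simpa only [coeff_taylorSeries, ← hw] using
    coeff_eq_of_two_mul_derivative_eq ((coeff_taylorSeries p 0).trans hp0)
      (derivative_taylorSeries_of_eqOn_bean_comp hω hp)

theorem IsLogCoeffs.eq_of_deriv_eq_bean_comp {f ω : ℂ → ℂ} {γ : ℕ → ℂ}
    (hf : DifferentiableOn ℂ f unitDisk) (h0 : f 0 = 0) (hγ : IsLogCoeffs f γ)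
    (hω : ω ∈ SchwarzClass) (hd : ∀ z ∈ unitDisk, deriv f z = bean (ω z))
    {w : ℕ → ℂ} (hw : w = taylorCoeff ω) :
    γ 1 = 1 / 8 * w 1 ∧
    γ 2 = 1 / 12 * (w 2 - 7 / 16 * w 1 ^ 2) ∧
    γ 3 = 1 / 16 * (w 3 - 5 / 6 * w 1 * w 2 - 1 / 12 * w 1 ^ 3) ∧
    γ 4 = 1 / 20 * (w 4 - 13 / 16 * w 1 * w 3 - 7 / 18 * w 2 ^ 2 - 85 / 288 * w 1 ^ 2 * w 2 +
      503 / 4608 * w 1 ^ 4) := by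
  have h1 : deriv f 0 = 1 := by rw [hd 0 zero_mem_unitDisk, hω.2.1, bean_zero]
  obtain ⟨-, p1, p2, p3, p4⟩ := taylorCoeff_eq_of_eqOn_bean_comp hω hd hw
  obtain ⟨g1, g2, g3, g4⟩ := hγ.eq_taylorCoeff hf h0 h1 rfl
  simp only [taylorCoeff_deriv, Nat.reduceAdd, Nat.cast_one, Nat.cast_ofNat] at p1 p2 p3 p4
  have a2 : taylorCoeff f 2 = w 1 / 4 := by linear_combination p1 / 2
  have a3 : taylorCoeff f 3 = (w 2 / 2 - w 1 ^ 2 / 8) / 3 := by linear_combination p2 / 3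
  have a4 : taylorCoeff f 4 = (w 3 / 2 - w 1 * w 2 / 4 - 5 / 48 * w 1 ^ 3) / 4 := by
    linear_combination p3 / 4
  have a5 : taylorCoeff f 5 = (w 4 / 2 - (2 * w 1 * w 3 + w 2 ^ 2) / 8 -
      5 / 16 * w 1 ^ 2 * w 2 + 17 / 384 * w 1 ^ 4) / 5 := by linear_combination p4 / 5
  simp only [a2, a3, a4, a5] at g1 g2 g3 g4
  refine ⟨?_, ?_, ?_, ?_⟩
  · rw [g1]; ring
  · rw [g2]; ring
  · rw [g3]; ring
  · rw [g4]; ring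

theorem norm_logCoeff_le {f : ℂ → ℂ} (hf : f ∈ ClassBT) {γ : ℕ → ℂ} (hγ : IsLogCoeffs f γ) :
    ∀ n ∈ Finset.Icc 1 4, ‖γ n‖ ≤ 1 / (4 * ((n : ℝ) + 1)) := by
  obtain ⟨⟨hd, h0, -, -⟩, ω, hωd, hω0, hωb, hsub⟩ := hf
  have hω : ω ∈ SchwarzClass := ⟨hωd, hω0, hωb⟩
  have hφ := dslope_mem_schurClass_of_mem_schwarzClass hω
  obtain ⟨g1, g2, g3, g4⟩ := hγ.eq_of_deriv_eq_bean_comp hd h0 hω hsub rfl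
  have k1 := norm_taylorCoeff_zero_le_one hφ
  have k2 := norm_taylorCoeff_one_add_le_one hφ (μ := -7 / 16) (by norm_num)
  have k3 := norm_taylorCoeff_two_add_le_one hφ (μ := -5 / 6) (ν := -1 / 12) (by norm_num)
  -- `α` and `β` solve `ν * μ + α = -85 / 288` and `α * μ + β = 503 / 4608`.
  have k4 := norm_taylorCoeff_three_add_le_one hφ (μ := -13 / 16) (ν := -7 / 18) (α := -11 / 18)
    (β := -595 / 1536) (by norm_num) (by norm_num) (by norm_num)
  simp only [taylorCoeff_dslope (analyticAt_zero hωd) hω0, Nat.reduceAdd, zero_add] at k1 k2 k3 k4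
  have norm_le_of_eq_mul {c : ℝ} (hc : 0 ≤ c) {u v : ℂ} (hu : ‖u‖ ≤ 1) (hv : v = c * u) :
      ‖v‖ ≤ c := by
    rw [hv, norm_mul, Complex.norm_of_nonneg hc]
    exact mul_le_of_le_one_right hc hu
  intro n hn
  obtain ⟨hn1, hn4⟩ := Finset.mem_Icc.1 hn
  interval_cases n
  · exact norm_le_of_eq_mul (by norm_num) k1 (by rw [g1]; push_cast; ring)
  · exact norm_le_of_eq_mul (by norm_num) k2 (by rw [g2]; push_cast; ring)
  · exact norm_le_of_eq_mul (by norm_num) k3 (by rw [g3]; push_cast; ring)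
  · exact norm_le_of_eq_mul (by norm_num) k4 (by rw [g4]; push_cast; ring)

end BoundedTurningClass

section ExtremalFunctions

theorem injOn_of_re_deriv_pos {s : Set ℂ} (hs : Convex ℝ s) {f f' : ℂ → ℂ}
    (hf : ∀ z ∈ s, HasDerivAt f (f' z) z) (hpos : ∀ z ∈ s, 0 < (f' z).re) : InjOn f s := by
  intro z hz w hw hzw
  by_contra hne
  have hmem : ∀ t ∈ Icc (0 : ℝ) 1, z + t * (w - z) ∈ s := fun t ht => by
    simpa only [real_smul] using hs.add_smul_sub_mem hz hw ht
  have hder : ∀ t ∈ Icc (0 : ℝ) 1,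
      HasDerivAt (fun t : ℝ => (f (z + t * (w - z)) * conj (w - z)).re)
        (f' (z + t * (w - z)) * (w - z) * conj (w - z)).re t := by
    intro t ht
    have hline : HasDerivAt (fun t : ℂ => z + t * (w - z)) (w - z) (t : ℂ) := by
      simpa using ((hasDerivAt_id (t : ℂ)).mul_const (w - z)).const_add z
    exact (((hf _ (hmem t ht)).comp (t : ℂ) hline).mul_const (conj (w - z))).real_of_complex
  obtain ⟨t, ht, hzero⟩ := exists_hasDerivAt_eq_zero zero_lt_one
    (fun t ht => (hder t ht).continuousAt.continuousWithinAt) (by simp [hzw])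
    fun t ht => hder t (Ioo_subset_Icc_self ht)
  have hnormSq : 0 < normSq (w - z) := normSq_pos.2 (sub_ne_zero.2 (Ne.symm hne))
  rw [mul_assoc, mul_conj, re_mul_ofReal] at hzero
  exact (mul_pos (hpos _ (hmem t (Ioo_subset_Icc_self ht))) hnormSq).ne' hzero

theorem hasDerivAt_integral_ray {g : ℂ → ℂ} {r : ℝ} (hg : DifferentiableOn ℂ g (Metric.ball 0 r))
    {z : ℂ} (hz : z ∈ Metric.ball 0 r) :
    HasDerivAt (fun z => ∫ s in (0 : ℝ)..1, g (s * z) * z) (g z) z := by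
  obtain ⟨G, hG0, hG⟩ := hg.isExactOn_ball.with_val_at 0 0
  have hprim : EqOn (fun z => ∫ s in (0 : ℝ)..1, g (s * z) * z) G (Metric.ball 0 r) := by
    intro w hw
    have hmem : ∀ s ∈ uIcc (0 : ℝ) 1, (s : ℂ) * w ∈ Metric.ball 0 r := fun s hs => by
      rw [Set.uIcc_of_le zero_le_one] at hs
      simpa only [real_smul] using (convex_ball (0 : ℂ) r).smul_mem_of_zero_mem
        (Metric.mem_ball_self (Metric.pos_of_mem_ball hw)) hw hs
    have hder : ∀ s ∈ uIcc (0 : ℝ) 1, HasDerivAt (fun s : ℝ => G (s * w)) (g (s * w) * w) s :=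
      fun s hs => by
        have hline : HasDerivAt (fun s : ℂ => s * w) w (s : ℂ) := by
          simpa using (hasDerivAt_id (s : ℂ)).mul_const w
        exact ((hG _ (hmem s hs)).comp (s : ℂ) hline).comp_ofReal
    have hcont : ContinuousOn (fun s : ℝ => g (s * w) * w) (uIcc 0 1) :=
      (hg.continuousOn.comp (by fun_prop) hmem).mul continuousOn_const
    simp [intervalIntegral.integral_eq_sub_of_hasDerivAt hder hcont.intervalIntegrable, hG0]
  exact (hG z hz).congr_of_eventuallyEq
    (hprim.eventuallyEq_of_mem (Metric.isOpen_ball.mem_nhds hz))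

variable {n : ℕ} {z : ℂ}

theorem pow_mem_schwarzClass (hn : n ≠ 0) : (fun z => z ^ n) ∈ SchwarzClass :=
  ⟨by fun_prop, zero_pow hn, fun z hz => by
    simpa only [norm_pow] using pow_lt_one₀ (norm_nonneg z) (mem_unitDisk.1 hz) hn⟩

theorem pow_mem_unitDisk (hn : n ≠ 0) (hz : z ∈ unitDisk) : z ^ n ∈ unitDisk :=
  mem_unitDisk.2 ((pow_mem_schwarzClass hn).2.2 z hz)

theorem hasDerivAt_extremal (hn : n ≠ 0) (hz : z ∈ unitDisk) :
    HasDerivAt (extremal n) (bean (z ^ n)) z :=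
  hasDerivAt_integral_ray
    (differentiableOn_bean.comp (differentiable_pow n).differentiableOn
      fun _ hw => pow_mem_unitDisk hn hw) hz

theorem extremal_zero (n : ℕ) : extremal n 0 = 0 := by simp [extremal]

theorem differentiableOn_extremal (hn : n ≠ 0) : DifferentiableOn ℂ (extremal n) unitDisk :=
  fun _ hz => (hasDerivAt_extremal hn hz).differentiableAt.differentiableWithinAt

theorem deriv_extremal (hn : n ≠ 0) (hz : z ∈ unitDisk) : deriv (extremal n) z = bean (z ^ n) :=
  (hasDerivAt_extremal hn hz).deriv

theorem extremal_mem_classBT (hn : n ≠ 0) : extremal n ∈ ClassBT := by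
  have hone : deriv (extremal n) 0 = 1 := by
    rw [deriv_extremal hn zero_mem_unitDisk, zero_pow hn, bean_zero]
  have hinj : InjOn (extremal n) unitDisk :=
    injOn_of_re_deriv_pos convex_unitDisk (fun z hz => hasDerivAt_extremal hn hz) fun z hz =>
      bean_re_pos (abs_im_lt_pi_div_two_of_mem_unitDisk (pow_mem_unitDisk hn hz))
  obtain ⟨hd, h0, hb⟩ := pow_mem_schwarzClass hn
  exact ⟨⟨differentiableOn_extremal hn, extremal_zero n, hone, hinj⟩, _, hd, h0, hb,
    fun z hz => deriv_extremal hn hz⟩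

theorem norm_logCoeff_extremal (hn : n ∈ Finset.Icc 1 4) {γ : ℕ → ℂ}
    (hγ : IsLogCoeffs (extremal n) γ) : ‖γ n‖ = 1 / (4 * ((n : ℝ) + 1)) := by
  obtain ⟨hn1, hn4⟩ := Finset.mem_Icc.1 hn
  have hn0 : n ≠ 0 := Nat.one_le_iff_ne_zero.1 hn1
  have hw : (fun k => if k = n then 1 else 0) = taylorCoeff (fun z => z ^ n) := by
    ext k
    rw [← coeff_taylorSeries, taylorSeries_pow_id, coeff_X_pow]
  obtain ⟨g1, g2, g3, g4⟩ := hγ.eq_of_deriv_eq_bean_comp (differentiableOn_extremal hn0)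
    (extremal_zero n) (pow_mem_schwarzClass hn0) (fun z hz => deriv_extremal hn0 hz) hw
  interval_cases n
  · rw [g1]; norm_num
  · rw [g2]; norm_num
  · rw [g3]; norm_num
  · rw [g4]; norm_num

end ExtremalFunctions

section Expansions

theorem taylorCoeff_bean :
    taylorCoeff bean 0 = 1 ∧ taylorCoeff bean 1 = 1 / 2 ∧ taylorCoeff bean 2 = -1 / 8 ∧
      taylorCoeff bean 3 = -5 / 48 ∧ taylorCoeff bean 4 = 17 / 384 := by
  have hid : (fun z : ℂ => z) ∈ SchwarzClass := by simpa using pow_mem_schwarzClass one_ne_zero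
  have hw : (fun k => if k = 1 then 1 else 0) = taylorCoeff (fun z => z) := by
    ext k
    rw [← coeff_taylorSeries, taylorSeries_id, coeff_X]
  obtain ⟨b0, b1, b2, b3, b4⟩ :=
    taylorCoeff_eq_of_eqOn_bean_comp (p := bean) hid (fun _ _ => rfl) hw
  exact ⟨b0, b1.trans (by norm_num), b2.trans (by norm_num), b3.trans (by norm_num),
    b4.trans (by norm_num)⟩

theorem isBigO_sub_sum_taylorCoeff {f : ℂ → ℂ} (hf : AnalyticAt ℂ f 0) (m : ℕ) :
    (fun z => f z - ∑ k ∈ range m, taylorCoeff f k * z ^ k) =O[𝓝 0] fun z => z ^ m := by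
  have h := hf.hasFPowerSeriesAt.isBigO_sub_partialSum_pow m
  simp_rw [← norm_pow, Asymptotics.isBigO_norm_right, zero_add] at h
  simpa [FormalMultilinearSeries.partialSum, taylorCoeff, mul_comm,
    FormalMultilinearSeries.apply_eq_pow_smul_coeff, FormalMultilinearSeries.coeff_ofScalars]
    using h

theorem isBigO_pow_succ_of_hasDerivAt {f f' : ℂ → ℂ} {m : ℕ} (h0 : f 0 = 0)
    (hf : ∀ᶠ z in 𝓝 0, HasDerivAt f (f' z) z) (hO : f' =O[𝓝 0] fun z => z ^ m) :
    f =O[𝓝 0] fun z => z ^ (m + 1) := by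
  have hderiv : fderiv ℝ f =O[𝓝 0] (‖· - (0 : ℂ)‖ ^ (m : ℝ)) := by
    simp only [sub_zero, Real.rpow_natCast, ← norm_pow, Asymptotics.isBigO_norm_right]
    refine Asymptotics.IsBigO.trans (.of_norm_eventuallyLE ?_) hO.norm_left
    filter_upwards [hf] with z hz
    rw [(hz.hasFDerivAt.restrictScalars ℝ).fderiv]
    simp
  have h := isBigO_norm_rpow_add_one_of_fderiv_of_apply_eq_zero m.cast_nonneg
    (hf.mono fun z hz => hz.differentiableAt.restrictScalars ℝ) hderiv h0
  simp only [sub_zero] at h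
  norm_cast at h
  simpa only [← norm_pow, Asymptotics.isBigO_norm_right] using h

theorem isBigO_extremal_sub_sum {n : ℕ} (hn : n ≠ 0) (m : ℕ) :
    (fun z => extremal n z -
      ∑ k ∈ range m, taylorCoeff bean k / ((n * k + 1 : ℕ) : ℂ) * z ^ (n * k + 1)) =O[𝓝 0]
      fun z => z ^ (n * m + 1) := by
  have hbean := isBigO_sub_sum_taylorCoeff (analyticAt_zero differentiableOn_bean) m
  have hpow : Filter.Tendsto (fun z : ℂ => z ^ n) (𝓝 0) (𝓝 0) := by
    simpa [hn] using (continuous_pow n (M := ℂ)).tendsto 0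
  refine isBigO_pow_succ_of_hasDerivAt (by simp [extremal_zero]) ?_
    (by simpa [Function.comp_def, ← pow_mul] using hbean.comp_tendsto hpow)
  filter_upwards [unitDisk_mem_nhds zero_mem_unitDisk] with z hz
  refine (hasDerivAt_extremal hn hz).fun_sub (HasDerivAt.fun_sum fun k _ => ?_)
  refine ((hasDerivAt_pow (n * k + 1) z).const_mul _).congr_deriv ?_
  have hk : ((n * k + 1 : ℕ) : ℂ) ≠ 0 := Nat.cast_ne_zero.2 (n * k).succ_ne_zero
  rw [Nat.add_sub_cancel, ← mul_assoc, div_mul_cancel₀ _ hk, pow_mul]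

theorem isBigO_extremal_one_sub :
    (fun z => extremal 1 z - (z + z ^ 2 / 4 - z ^ 3 / 24 - 5 * z ^ 4 / 192 + 17 * z ^ 5 / 1920))
      =O[𝓝 (0 : ℂ)] fun z => z ^ 6 := by
  obtain ⟨b0, b1, b2, b3, b4⟩ := taylorCoeff_bean
  refine (isBigO_extremal_sub_sum one_ne_zero 5).congr_left fun z => ?_
  simp only [Finset.sum_range_succ, Finset.sum_range_zero, b0, b1, b2, b3, b4]
  push_cast
  ring

theorem isBigO_extremal_two_sub :
    (fun z => extremal 2 z - (z + z ^ 3 / 6 - z ^ 5 / 40 - 5 * z ^ 7 / 336))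
      =O[𝓝 (0 : ℂ)] fun z => z ^ 9 := by
  obtain ⟨b0, b1, b2, b3, -⟩ := taylorCoeff_bean
  refine (isBigO_extremal_sub_sum two_ne_zero 4).congr_left fun z => ?_
  simp only [Finset.sum_range_succ, Finset.sum_range_zero, b0, b1, b2, b3]
  push_cast
  ring

theorem isBigO_extremal_three_sub :
    (fun z => extremal 3 z - (z + z ^ 4 / 8 - z ^ 7 / 56)) =O[𝓝 (0 : ℂ)] fun z => z ^ 10 := by
  obtain ⟨b0, b1, b2, -, -⟩ := taylorCoeff_bean
  refine (isBigO_extremal_sub_sum three_ne_zero 3).congr_left fun z => ?_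
  simp only [Finset.sum_range_succ, Finset.sum_range_zero, b0, b1, b2]
  push_cast
  ring

theorem isBigO_extremal_four_sub :
    (fun z => extremal 4 z - (z + z ^ 5 / 10 - z ^ 9 / 72)) =O[𝓝 (0 : ℂ)] fun z => z ^ 13 := by
  obtain ⟨b0, b1, b2, -, -⟩ := taylorCoeff_bean
  refine (isBigO_extremal_sub_sum four_ne_zero 3).congr_left fun z => ?_
  simp only [Finset.sum_range_succ, Finset.sum_range_zero, b0, b1, b2]
  push_cast
  ring

end Expansions

end BoundedTurning

theorem mainTheorem1 :
    (∀ f ∈ BoundedTurning.ClassBT,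
      (∃ γ : ℕ → ℂ, BoundedTurning.IsLogCoeffs f γ) ∧
      ∀ a γ : ℕ → ℂ, a = BoundedTurning.taylorCoeff f → BoundedTurning.IsLogCoeffs f γ →
        (γ 1 = 1 / 2 * a 2 ∧
          γ 2 = 1 / 2 * (a 3 - 1 / 2 * a 2 ^ 2) ∧
          γ 3 = 1 / 2 * (a 4 - a 2 * a 3 + 1 / 3 * a 2 ^ 3) ∧
          γ 4 = 1 / 2 * (a 5 - a 2 * a 4 + a 2 ^ 2 * a 3 - 1 / 2 * a 3 ^ 2 - 1 / 4 * a 2 ^ 4)) ∧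
        ∀ n ∈ Finset.Icc 1 4, ‖γ n‖ ≤ 1 / (4 * ((n : ℝ) + 1))) ∧
    (∀ n ∈ Finset.Icc 1 4,
      BoundedTurning.extremal n ∈ BoundedTurning.ClassBT ∧
      ∀ γ : ℕ → ℂ, BoundedTurning.IsLogCoeffs (BoundedTurning.extremal n) γ →
        ‖γ n‖ = 1 / (4 * ((n : ℝ) + 1))) ∧
    ((fun z => BoundedTurning.extremal 1 z -
        (z + z ^ 2 / 4 - z ^ 3 / 24 - 5 * z ^ 4 / 192 + 17 * z ^ 5 / 1920))
        =O[𝓝 (0 : ℂ)] (fun z => z ^ 6) ∧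
      (fun z => BoundedTurning.extremal 2 z - (z + z ^ 3 / 6 - z ^ 5 / 40 - 5 * z ^ 7 / 336))
        =O[𝓝 (0 : ℂ)] (fun z => z ^ 9) ∧
      (fun z => BoundedTurning.extremal 3 z - (z + z ^ 4 / 8 - z ^ 7 / 56))
        =O[𝓝 (0 : ℂ)] (fun z => z ^ 10) ∧
      (fun z => BoundedTurning.extremal 4 z - (z + z ^ 5 / 10 - z ^ 9 / 72))
        =O[𝓝 (0 : ℂ)] (fun z => z ^ 13)) := by
  refine ⟨fun f hf => ⟨BoundedTurning.exists_isLogCoeffs hf.1, fun a γ ha hγ => ?_⟩,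
    fun n hn => ?_, BoundedTurning.isBigO_extremal_one_sub, BoundedTurning.isBigO_extremal_two_sub,
    BoundedTurning.isBigO_extremal_three_sub, BoundedTurning.isBigO_extremal_four_sub⟩
  · obtain ⟨hd, h0, h1, -⟩ := hf.1
    exact ⟨hγ.eq_taylorCoeff hd h0 h1 ha, BoundedTurning.norm_logCoeff_le hf hγ⟩
  · have hn0 : n ≠ 0 := Nat.one_le_iff_ne_zero.1 (Finset.mem_Icc.1 hn).1
    exact ⟨BoundedTurning.extremal_mem_classBT hn0, fun γ hγ =>
      BoundedTurning.norm_logCoeff_extremal hn hγ⟩
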